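/- Let $G$ be a finite simple graph with vertex set $V(G)=\{x_1,\dots,x_n\}$, let $\mathbb K$ be any field, and let $R=\mathbb K[x_1,\dots,x_n]$. Let $\Delta_G$ be the independence complex of $G$, whose faces are the independent sets of $G$ (including the empty set), and let $\mathbb K[\Delta_G]=R/I_{\Delta_G}$ be its Stanley--Reisner ring, where $I_{\Delta_G}$ is generated by the monomials $\prod_{x\in F}x$ with $F\subseteq V(G)$, $F\notin\Delta_G$. (The ideal $I_{\Delta_G}$ equals the edge ideal $I(G)$ generated by the monomials $x_ix_j$ with $\{x_i,x_j\}$ an edge of $G$.) Let $\operatorname{pdim}\mathbb K[\Delta_G]$ denote the projective dimension of $\mathbb K[\Delta_G]$ as an $R$-module, and let $\operatorname{bight} I(G)$, the big height of $I(G)$, be the maximum cardinality of an inclusion-minimal vertex cover of $G$. Then $$\operatorname{pdim}\mathbb K[\Delta_G]\;\ge\;\operatorname{bight} I(G)\;\ge\;\max_{1\le i\le n}\deg_G(x_i)$$ (the maximum is read as $0$ if $n=0$). -/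

import Mathlib

/-- A simplicial complex on the vertex set `V`: a collection of finite subsets of `V` (the faces,
among them the empty face, unlike in `AbstractSimplicialComplex`) that contains every singleton and is closed under passing to subsets. -/
structure SimplicialComplexOn (V : Type*) where
  faces : Set (Finset V)
  empty_mem : ∅ ∈ faces
  singleton_mem : ∀ x : V, {x} ∈ faces
  subset_mem : ∀ ⦃F H : Finset V⦄, F ∈ faces → H ⊆ F → H ∈ faces

/-- The Stanley-Reisner ideal `I_Δ = ⟨x_F | F ∉ Δ⟩`, where `x_F` is the product of the variables
indexed by `F`, in the polynomial ring `K[x | x ∈ V]`. -/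
noncomputable def SimplicialComplexOn.stanleyReisnerIdeal {V : Type*} (Δ : SimplicialComplexOn V)
    (K : Type*) [Field K] : Ideal (MvPolynomial V K) :=
  Ideal.span {m | ∃ F : Finset V, F ∉ Δ.faces ∧ m = ∏ x ∈ F, MvPolynomial.X x}

/-- The Stanley-Reisner ring `K[Δ] = K[x | x ∈ V] / I_Δ`. -/
abbrev SimplicialComplexOn.StanleyReisnerRing {V : Type*} (Δ : SimplicialComplexOn V)
    (K : Type*) [Field K] : Type _ :=
  MvPolynomial V K ⧸ Δ.stanleyReisnerIdeal K

/-- The independence complex `Δ_G`, whose faces are the independent sets of `G`. -/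
def SimpleGraph.independenceComplex {V : Type*} (G : SimpleGraph V) : SimplicialComplexOn V where
  faces := {F | G.IsIndepSet (F : Set V)}
  empty_mem := by simp [SimpleGraph.IsIndepSet]
  singleton_mem := fun x => by simp [SimpleGraph.IsIndepSet]
  subset_mem := fun _ _ hF hHF => Set.Pairwise.mono (Finset.coe_subset.2 hHF) hF

open Classical in
/-- The big height `bight I(G)` of the edge ideal of `G`: the maximum cardinality of a minimal
vertex cover of `G` (minimal with respect to inclusion). -/
noncomputable def SimpleGraph.bigHeight {V : Type*} [Fintype V] (G : SimpleGraph V) : ℕ :=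
  (Finset.univ.filter fun C : Finset V =>
    Minimal (fun D : Finset V => G.IsVertexCover (D : Set V)) C).sup Finset.card

/-! For a minimal vertex cover `C`, the variables in `C` generate a minimal prime `P` of the edge
ideal, and the two ideals agree after localizing at `P` (`map_stanleyReisnerIdeal_eq`). There `P` is
generated by a regular sequence of `C.card` variables, so the localized quotient has projective
dimension `C.card`; localization cannot increase projective dimension, which gives the first bound.
For the second, a minimal cover avoiding a vertex must contain all its neighbors. -/

open CategoryTheory in
/-- Localizing a cyclic module at a submonoid does not increase its projective dimension. -/
theorem Ideal.projectiveDimension_quotient_map_localization_le {R : Type*} [CommRing R]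
    (S : Submonoid R) (I : Ideal R) :
    projectiveDimension (ModuleCat.of (Localization S)
        (Localization S ⧸ I.map (algebraMap R (Localization S)))) ≤
      projectiveDimension (ModuleCat.of R (R ⧸ I)) := by
  let M := ModuleCat.of R (R ⧸ I)
  have := ModuleCat.localizedModule_isLocalizedModule M S
  let f := I.toLocalizedQuotient' (Localization S) S (Algebra.linearMap R (Localization S))
  let e := LinearEquiv.extendScalarsOfIsLocalization S (Localization S)
    (IsLocalizedModule.linearEquiv S (M.localizedModuleMkLinearMap S) f)
  have hI : I.localized' (Localization S) S (Algebra.linearMap R (Localization S)) =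
      I.map (algebraMap R (Localization S)) := Ideal.localized'_eq_map ..
  rw [← hI, ← ModuleCat.projectiveDimension_eq_of_linearEquiv (M := M.localizedModule S)
    (N := ModuleCat.of (Localization S) (Localization S ⧸
      I.localized' (Localization S) S (Algebra.linearMap R (Localization S)))) e]
  exact ModuleCat.projectiveDimension_le_projectiveDimension_of_isLocalizedModule S M

namespace MvPolynomial

universe u v

variable {σ : Type u} {R : Type v} [CommRing R]

theorem sub_aeval_ite_mem_span_X (s : Set σ) [DecidablePred (· ∈ s)] (p : MvPolynomial σ R) :
    p - aeval (fun i => if i ∈ s then 0 else X i) p ∈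
      Ideal.span (X '' s : Set (MvPolynomial σ R)) := by
  induction p using MvPolynomial.induction_on with
  | C a => simp
  | add p q hp hq => simpa [add_sub_add_comm] using add_mem hp hq
  | mul_X p i hp =>
    by_cases hi : i ∈ s
    · simpa [hi] using Ideal.mul_mem_left _ p (Ideal.subset_span (Set.mem_image_of_mem X hi))
    · simpa [hi, sub_mul] using Ideal.mul_mem_right (X i) _ hp

theorem span_X_image_eq_ker_aeval (s : Set σ) [DecidablePred (· ∈ s)] :
    Ideal.span (X '' s : Set (MvPolynomial σ R)) =
      RingHom.ker (aeval (R := R) fun i => if i ∈ s then 0 else (X i : MvPolynomial σ R)) := by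
  refine le_antisymm (Ideal.span_le.2 ?_) fun p hp => ?_
  · rintro _ ⟨i, hi, rfl⟩
    simp [RingHom.mem_ker, show i ∈ s from hi]
  · have h := sub_aeval_ite_mem_span_X s p
    rwa [RingHom.mem_ker.1 hp, sub_zero] at h

/-- Setting the variables in `s` to zero has this ideal as kernel and takes values in a domain. -/
theorem isPrime_span_X_image [IsDomain R] (s : Set σ) :
    (Ideal.span (X '' s : Set (MvPolynomial σ R))).IsPrime := by
  classical
  rw [span_X_image_eq_ker_aeval]
  exact RingHom.ker_isPrime _

theorem X_mem_span_X_image_iff [Nontrivial R] {s : Set σ} {i : σ} :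
    (X i : MvPolynomial σ R) ∈ Ideal.span (X '' s) ↔ i ∈ s := by
  classical
  simp [mem_ideal_span_X_image, support_X, Finsupp.single_apply]

theorem ofList_map_X (l : List σ) :
    Ideal.ofList (l.map (X : σ → MvPolynomial σ R)) = Ideal.span (X '' {i | i ∈ l}) := by
  simp [Ideal.ofList, Set.image]

open RingTheory.Sequence in
/-- Distinct variables form a weakly regular sequence. -/
theorem isWeaklyRegular_map_X [IsDomain R] {l : List σ} (hl : l.Nodup) :
    IsWeaklyRegular (MvPolynomial σ R) (l.map (X : σ → MvPolynomial σ R)) := by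
  refine ⟨fun i hi => ?_⟩
  rw [← List.map_take, smul_eq_mul, Ideal.mul_top, ofList_map_X, List.getElem_map,
    isSMulRegular_quotient_iff_mem_of_smul_mem]
  intro p hp
  have := isPrime_span_X_image (R := R) {j | j ∈ l.take i}
  -- The earlier variables span a prime ideal, so the next one is a nonzerodivisor modulo it unless
  -- it repeats an earlier one.
  refine (this.mem_or_mem hp).resolve_left fun h => ?_
  rw [List.length_map] at hi
  have h' : l[i] ∈ l.take i :=
    (X_mem_span_X_image_iff (s := {j | j ∈ l.take i})).1 h
  obtain ⟨j, hj, hji⟩ := List.mem_take_iff_getElem.1 h'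
  have := (hl.getElem_inj_iff).1 hji
  omega

open CategoryTheory in
/-- Localized at the prime ideal generated by the variables in `s`, the quotient by this ideal has
projective dimension the number of these variables. -/
theorem projectiveDimension_localization_quotient_span_X [IsDomain R] [IsNoetherianRing R]
    [Finite σ] (s : Finset σ) (P : Ideal (MvPolynomial σ R)) [P.IsPrime]
    (hP : P = Ideal.span (X '' (s : Set σ))) :
    projectiveDimension (ModuleCat.of (Localization.AtPrime P)
      (Localization.AtPrime P ⧸ P.map (algebraMap _ (Localization.AtPrime P)))) = s.card := by
  have hP' : P = Ideal.ofList (s.toList.map X) := by simp [ofList_map_X, hP]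
  -- Weak regularity becomes regularity because the variables lie in `P`, hence in the maximal ideal
  -- of the localization.
  have hreg := (isWeaklyRegular_map_X (R := R) s.nodup_toList).isRegular_of_isLocalization_of_mem
    (Localization.AtPrime P) P fun r hr => hP' ▸ Ideal.subset_span hr
  have h := ModuleCat.projectiveDimension_quotient_eq_length.{max u v} _ hreg
  rw [← Ideal.map_ofList, ← hP', List.length_map, List.length_map, Finset.length_toList] at h
  rw [← h]
  exact ModuleCat.projectiveDimension_eq_of_linearEquiv (Shrink.linearEquiv _ _).symm

end MvPolynomial

namespace SimpleGraph

variable {V : Type*} (G : SimpleGraph V)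

theorem X_mul_X_mem_stanleyReisnerIdeal (K : Type*) [Field K] {v w : V} (h : G.Adj v w) :
    (MvPolynomial.X v * MvPolynomial.X w : MvPolynomial V K) ∈
      G.independenceComplex.stanleyReisnerIdeal K := by
  classical
  refine Ideal.subset_span ⟨{v, w}, fun hF => ?_, (Finset.prod_pair h.ne).symm⟩
  exact hF (by simp) (by simp) h.ne h

theorem stanleyReisnerIdeal_le_span_X (K : Type*) [Field K] {C : Set V}
    (hC : G.IsVertexCover C) :
    G.independenceComplex.stanleyReisnerIdeal K ≤ Ideal.span (MvPolynomial.X '' C) := by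
  refine Ideal.span_le.2 ?_
  rintro _ ⟨F, hF, rfl⟩
  -- A set missing the cover lies in its independent complement, so a non-face must meet `C`.
  obtain ⟨v, hvF, hvC⟩ : ∃ v ∈ F, v ∈ C := by
    by_contra! h
    exact hF ((G.isIndepSet_compl_iff_isVertexCover.2 hC).mono fun v hv => h v hv)
  exact Ideal.mem_of_dvd _ (Finset.dvd_prod_of_mem _ hvF)
    (Ideal.subset_span (Set.mem_image_of_mem _ hvC))

variable {G}

/-- Every vertex of a minimal vertex cover has a neighbor outside of it. -/
theorem exists_adj_notMem_of_minimal_isVertexCover {C : Finset V}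
    (hC : Minimal (fun D : Finset V => G.IsVertexCover (D : Set V)) C) {v : V} (hv : v ∈ C) :
    ∃ w, G.Adj v w ∧ w ∉ C := by
  classical
  by_contra! h
  -- If all neighbors of `v` were in `C`, erasing `v` would leave a smaller cover.
  refine Finset.notMem_erase v C (hC.2 (y := C.erase v) (fun a b hab => ?_) (C.erase_subset v) hv)
  have := hC.prop hab
  have := hab.ne
  simp only [Finset.mem_coe, Finset.mem_erase] at *
  grind [hab.symm]

/-- The Stanley-Reisner ideal of the independence complex and the prime ideal of a minimal vertex
cover agree after localization at the latter. -/
theorem map_stanleyReisnerIdeal_eq (K : Type*) [Field K] {C : Finset V}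
    (hC : Minimal (fun D : Finset V => G.IsVertexCover (D : Set V)) C)
    (P : Ideal (MvPolynomial V K)) [P.IsPrime]
    (hP : P = Ideal.span (MvPolynomial.X '' (C : Set V))) :
    (G.independenceComplex.stanleyReisnerIdeal K).map (algebraMap _ (Localization.AtPrime P)) =
      P.map (algebraMap _ (Localization.AtPrime P)) := by
  refine le_antisymm (Ideal.map_mono (hP ▸ G.stanleyReisnerIdeal_le_span_X K hC.prop)) ?_
  rw [Ideal.map_le_iff_le_comap]
  refine hP.trans_le (Ideal.span_le.2 ?_)
  rintro _ ⟨v, hv, rfl⟩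
  obtain ⟨w, hvw, hw⟩ := exists_adj_notMem_of_minimal_isVertexCover hC hv
  -- Since `w` is outside `C`, its variable is invertible at `P` and cancels from the edge monomial.
  have hu : IsUnit (algebraMap _ (Localization.AtPrime P) (MvPolynomial.X w)) :=
    IsLocalization.map_units _ (⟨MvPolynomial.X w, fun h => hw
      (MvPolynomial.X_mem_span_X_image_iff.1 (hP ▸ h))⟩ : P.primeCompl)
  have h := Ideal.mem_map_of_mem (algebraMap _ (Localization.AtPrime P))
    (G.X_mul_X_mem_stanleyReisnerIdeal K hvw)
  rw [map_mul] at h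
  exact (Ideal.mul_unit_mem_iff_mem _ hu).1 h

theorem card_le_projectiveDimension_stanleyReisnerRing (K : Type*) [Field K] [Finite V]
    {C : Finset V} (hC : Minimal (fun D : Finset V => G.IsVertexCover (D : Set V)) C) :
    (C.card : WithBot ℕ∞) ≤ CategoryTheory.projectiveDimension
      (ModuleCat.of (MvPolynomial V K) (G.independenceComplex.StanleyReisnerRing K)) := by
  obtain ⟨P, hP⟩ : ∃ P, P = Ideal.span (MvPolynomial.X '' (C : Set V) : Set (MvPolynomial V K)) :=
    ⟨_, rfl⟩
  have : P.IsPrime := hP ▸ MvPolynomial.isPrime_span_X_image _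
  rw [← MvPolynomial.projectiveDimension_localization_quotient_span_X C P hP,
    ← map_stanleyReisnerIdeal_eq K hC P hP]
  exact Ideal.projectiveDimension_quotient_map_localization_le _ _

theorem degree_le_bigHeight [Fintype V] (v : V) [Fintype (G.neighborSet v)] :
    G.degree v ≤ G.bigHeight := by
  classical
  have hcover : G.IsVertexCover ((Finset.univ.erase v : Finset V) : Set V) := by
    intro a b hab
    have := hab.ne
    simp only [Finset.coe_erase, Finset.coe_univ, Set.mem_sdiff, Set.mem_univ, true_and,
      Set.mem_singleton_iff]
    grind
  -- Shrinking the complement of `v` to a minimal cover keeps `v` out.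
  obtain ⟨C, hCv, hC⟩ := exists_minimal_le_of_wellFoundedLT
    (fun D : Finset V => G.IsVertexCover (D : Set V)) _ hcover
  have hv : v ∉ C := fun h => Finset.notMem_erase v _ (hCv h)
  rw [← card_neighborFinset_eq_degree]
  refine (Finset.card_le_card fun w hw => ?_).trans
    (Finset.le_sup (f := Finset.card) (Finset.mem_filter.2 ⟨Finset.mem_univ C, hC⟩))
  exact (hC.prop ((mem_neighborFinset ..).1 hw)).resolve_left hv

end SimpleGraph

theorem mainTheorem1 (K : Type*) [Field K] {V : Type*} [Fintype V] (G : SimpleGraph V)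
    [DecidableRel G.Adj] :
    (G.bigHeight : WithBot ℕ∞) ≤
        CategoryTheory.projectiveDimension
          (ModuleCat.of (MvPolynomial V K) (G.independenceComplex.StanleyReisnerRing K)) ∧
      G.maxDegree ≤ G.bigHeight := by
  classical
  refine ⟨?_, G.maxDegree_le_of_forall_degree_le _ fun v => SimpleGraph.degree_le_bigHeight v⟩
  -- Some minimal cover exists, so the supremum is attained and is not the default value for an
  -- empty set.
  obtain ⟨C₀, -, hC₀⟩ := exists_minimal_le_of_wellFoundedLT
    (fun D : Finset V => G.IsVertexCover (D : Set V)) Finset.univ (by simp)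
  obtain ⟨C, hC, hcard⟩ := Finset.exists_mem_eq_sup (Finset.univ.filter fun C : Finset V =>
    Minimal (fun D : Finset V => G.IsVertexCover (D : Set V)) C)
    ⟨C₀, Finset.mem_filter.2 ⟨Finset.mem_univ _, hC₀⟩⟩ Finset.card
  have h : G.bigHeight = C.card := by
    rw [← hcard, SimpleGraph.bigHeight]
  rw [h]
  exact SimpleGraph.card_le_projectiveDimension_stanleyReisnerRing K (Finset.mem_filter.1 hC).2
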